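/- Consider a unitary rational conformal model with finitely many primaries: a finite set of primaries with a vacuum $0$, a symmetric unitary matrix $S$ with $S_{0p}>0$ for all primaries $p$, and fusion coefficients $N_{pq}^{r}\in\mathbb{Z}_{\ge 0}$ given by Verlinde's formula $N_{pq}^{r}=\sum_{s}S_{ps}S_{qs}\overline{S_{rs}}/S_{0s}$. Put $d_p=S_{0p}/S_{00}$ and $\rho_p(\alpha)=S_{\alpha p}/S_{0p}$ (the irreducible representations of the fusion algebra). Let $\mathscr{L}$ be the deconstruction lattice, i.e. the collection, ordered by inclusion, of all sets of primaries that contain the vacuum and are closed under the fusion product ($p,q\in\mathfrak g$ and $N_{pq}^r>0$ imply $r\in\mathfrak g$). For $\mathfrak g\in\mathscr L$ a $\mathfrak g$-class is an equivalence class of primaries for the relation $\rho_p|_{\mathfrak g}=\rho_q|_{\mathfrak g}$; the trivial class $\mathfrak g^{\perp}$ is the $\mathfrak g$-class of the vacuum; a $\mathfrak g$-class $\mathtt C$ is central if its mass $\sum_{p\in \mathtt C}d_p^2$ is minimal among all $\mathfrak g$-classes. The central $\mathfrak g$-classes form an abelian group $\mathtt Z(\mathfrak g)$, the center, under the product $\mathtt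 z\mathtt w=\{r: N_{pq}^r>0 \text{ for some } p\in\mathtt z,\ q\in\mathtt w\}$, with identity $\mathfrak g^\perp$. The central character of $\mathtt z\in\mathtt Z(\mathfrak g)$ is $\varpi_{\mathtt z}(\alpha)=\rho_p(\alpha)/d_\alpha$ for $\alpha\in\mathfrak g$ and any $p\in\mathtt z$. For a subgroup $H<\mathtt Z(\mathfrak g)$, the central quotient is $\mathfrak g/H=\{\alpha\in\mathfrak g:\varpi_{\mathtt z}(\alpha)=1\text{ for all }\mathtt z\in H\}\in\mathscr L$, and $\boldsymbol\partial\mathfrak g=\mathfrak g/\mathtt Z(\mathfrak g)$ is the maximal central quotient. For $\mathfrak h\subseteq\mathfrak g$ in $\mathscr L$, the restriction homomorphism $\mathtt Z(\mathfrak g)\to\mathtt Z(\mathfrak h)$ sends a central $\mathfrak g$-class to the unique $\mathfrak h$-class containing it; $\mathtt Z(\mathfrak g|\mathfrak h)=\{\mathtt z\in\mathtt Z(\mathfrak g):\mathtt z\subseteq\mathfrak h^\perp\}$ denotes its kernel and $\mathtt I(\mathfrak g|\mathfrak h)$ its image. For a set $H$ of central classes, $\cup H$ denotes the union of its members, as a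 set of primaries. **Theorem.** Let $\mathfrak g,\mathfrak h\in\mathscr L$, and suppose that $\mathfrak h$ is a central quotient of $\mathfrak g$, i.e. $\mathfrak h=\mathfrak g/H$ for some subgroup $H<\mathtt Z(\mathfrak g)$. Then $$\cup\,\mathtt Z(\mathfrak g|\mathfrak h)=\mathfrak h^{\perp}\qquad\text{and}\qquad \cup\,\mathtt I(\mathfrak g|\mathfrak h)=(\boldsymbol\partial\mathfrak g)^{\perp},$$ hence $\mathfrak h=\mathfrak g/\mathtt Z(\mathfrak g|\mathfrak h)$ and $\mathfrak h/\mathtt I(\mathfrak g|\mathfrak h)=\boldsymbol\partial\mathfrak g$; in particular $\boldsymbol\partial\mathfrak g\subseteq\mathfrak h$ and $$\mathtt I(\mathfrak g|\mathfrak h)=\mathtt Z(\mathfrak h|\boldsymbol\partial\mathfrak g).$$ -/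

import Mathlib

open scoped ComplexConjugate

noncomputable section

/-- The data of a (unitary) rational conformal model with finite set `ι` of primaries on which the
deconstruction lattice depends: the vacuum, the modular `S`-matrix (symmetric, unitary, with
positive vacuum row), and the fusion coefficients `N p q r` (the multiplicity of `r` in the fusion
product of `p` and `q`), which are natural numbers related to `S` by Verlinde's formula.
(That `S * S` is a permutation matrix, the charge conjugation, follows: its entries are
`N p q vac`.) -/
structure ConformalModel (ι : Type*) [Fintype ι] [DecidableEq ι] where
  vac : ι
  S : Matrix ι ι ℂ
  S_symm : S.transpose = S
  S_unitary : S ∈ Matrix.unitaryGroup ι ℂ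
  S_vac_re : ∀ p, 0 < (S vac p).re
  S_vac_im : ∀ p, (S vac p).im = 0
  N : ι → ι → ι → ℕ
  verlinde : ∀ p q r, (N p q r : ℂ) = ∑ s, S p s * S q s * conj (S r s) / S vac s

namespace ConformalModel

variable {ι : Type*} [Fintype ι] [DecidableEq ι] (M : ConformalModel ι)

/-- The quantum dimension of a primary. -/
def qdim (p : ι) : ℝ := (M.S M.vac p).re / (M.S M.vac M.vac).re

/-- The irreducible representation of the fusion algebra corresponding to the primary `p`,
evaluated at the primary `α`. -/
def irrep (p α : ι) : ℂ := M.S α p / M.S M.vac p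

/-! ### Basic facts on the fusion algebra -/

lemma S_comm (p q : ι) : M.S p q = M.S q p := by
  conv_lhs => rw [← M.S_symm]
  rfl

lemma S_vac_ne (p : ι) : M.S M.vac p ≠ 0 := by
  intro h
  have := M.S_vac_re p
  rw [h] at this
  simp at this

lemma S_vac_eq (p : ι) : ((M.S M.vac p).re : ℂ) = M.S M.vac p := by
  apply Complex.ext <;> simp [M.S_vac_im p]

lemma conj_S_vac (p : ι) : conj (M.S M.vac p) = M.S M.vac p := by
  rw [← M.S_vac_eq p, Complex.conj_ofReal]

lemma row_orth (p q : ι) : ∑ s, M.S p s * conj (M.S q s) = if p = q then 1 else 0 := by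
  have h := congrFun (congrFun (Matrix.mem_unitaryGroup_iff.1 M.S_unitary) p) q
  simpa [Matrix.mul_apply, Matrix.one_apply, Matrix.star_apply] using h

lemma col_orth (s t : ι) : ∑ r, conj (M.S r s) * M.S r t = if s = t then 1 else 0 := by
  have h := congrFun (congrFun (Matrix.mem_unitaryGroup_iff'.1 M.S_unitary) s) t
  simpa [Matrix.mul_apply, Matrix.one_apply, Matrix.star_apply] using h

lemma fusion_S (p q s : ι) :
    ∑ r, (M.N p q r : ℂ) * M.S r s = M.S p s * M.S q s / M.S M.vac s := by
  calc ∑ r, (M.N p q r : ℂ) * M.S r s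
      = ∑ r, ∑ t, (M.S p t * M.S q t / M.S M.vac t) * (conj (M.S r t) * M.S r s) := by
        refine Finset.sum_congr rfl fun r _ => ?_
        rw [M.verlinde, Finset.sum_mul]
        exact Finset.sum_congr rfl fun t _ => by ring
    _ = ∑ t, (M.S p t * M.S q t / M.S M.vac t) * ∑ r, (conj (M.S r t) * M.S r s) := by
        rw [Finset.sum_comm]
        exact Finset.sum_congr rfl fun t _ => by rw [Finset.mul_sum]
    _ = _ := by simp [M.col_orth]

/-- `irrep s` is a representation of the fusion algebra. -/
lemma irrep_mul (s p q : ι) :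
    M.irrep s p * M.irrep s q = ∑ r, (M.N p q r : ℂ) * M.irrep s r := by
  have h := M.fusion_S p q s
  have h0 := M.S_vac_ne s
  simp only [irrep]
  calc M.S p s / M.S M.vac s * (M.S q s / M.S M.vac s)
      = (M.S p s * M.S q s / M.S M.vac s) / M.S M.vac s := by ring
    _ = _ := by
      rw [← h, Finset.sum_div]
      exact Finset.sum_congr rfl fun r _ => by ring

lemma irrep_vac_right (s : ι) : M.irrep s M.vac = 1 := div_self (M.S_vac_ne s)

lemma irrep_vac (α : ι) : M.irrep M.vac α = M.qdim α := by
  simp only [irrep, qdim]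
  push_cast
  rw [M.S_vac_eq, M.S_vac_eq, M.S_comm]

lemma qdim_pos (p : ι) : 0 < M.qdim p := div_pos (M.S_vac_re p) (M.S_vac_re _)

lemma qdim_ne (p : ι) : (M.qdim p : ℂ) ≠ 0 := by exact_mod_cast (M.qdim_pos p).ne'

lemma qdim_mul (p q : ι) : M.qdim p * M.qdim q = ∑ r, (M.N p q r : ℝ) * M.qdim r := by
  have h := M.irrep_mul M.vac p q
  simp only [irrep_vac] at h
  exact_mod_cast h

lemma norm_irrep_le (s α : ι) : ‖M.irrep s α‖ ≤ M.qdim α := by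
  obtain ⟨q, -, hq⟩ := Finset.exists_max_image Finset.univ
    (fun r => ‖M.irrep s r‖ / M.qdim r) ⟨M.vac, Finset.mem_univ _⟩
  set m := ‖M.irrep s q‖ / M.qdim q with hm
  have hle : ∀ r, ‖M.irrep s r‖ ≤ m * M.qdim r := fun r =>
    (div_le_iff₀ (M.qdim_pos r)).1 (hq r (Finset.mem_univ r))
  have hmpos : 0 < m := by
    have h1 := hle M.vac
    rw [M.irrep_vac_right, norm_one] at h1
    by_contra hneg
    have := mul_nonpos_of_nonpos_of_nonneg (not_lt.1 hneg) (M.qdim_pos M.vac).le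
    linarith
  have hq' : ‖M.irrep s q‖ = m * M.qdim q := by
    rw [hm, div_mul_cancel₀ _ (M.qdim_pos q).ne']
  have h2 : ‖M.irrep s α‖ * ‖M.irrep s q‖ ≤ m * (M.qdim α * M.qdim q) := by
    rw [← norm_mul, M.irrep_mul, M.qdim_mul, Finset.mul_sum]
    refine (norm_sum_le _ _).trans (Finset.sum_le_sum fun r _ => ?_)
    rw [norm_mul, Complex.norm_natCast]
    calc (M.N α q r : ℝ) * ‖M.irrep s r‖ ≤ (M.N α q r : ℝ) * (m * M.qdim r) :=
          mul_le_mul_of_nonneg_left (hle r) (Nat.cast_nonneg _)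
      _ = _ := by ring
  rw [hq'] at h2
  have h3 : 0 < m * M.qdim q := mul_pos hmpos (M.qdim_pos q)
  refine le_of_mul_le_mul_right ?_ h3
  linarith

lemma irrep_swap (p α : ι) : M.irrep p α * M.qdim p = M.irrep α p * M.qdim α := by
  simp only [irrep, qdim]
  push_cast
  simp only [M.S_vac_eq]
  have h1 := M.S_vac_ne p
  have h2 := M.S_vac_ne α
  have h3 := M.S_vac_ne M.vac
  rw [M.S_comm α p]
  field_simp

lemma irrep_scalar_swap {p α : ι} {u : ℂ} (h : M.irrep p α = u * M.qdim α) :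
    M.irrep α p = u * M.qdim p := by
  have h1 := M.irrep_swap p α
  rw [h] at h1
  exact mul_right_cancel₀ (M.qdim_ne α) (by rw [← h1]; ring)

/-- The case of equality in the triangle inequality, for sums weighted by multiplicities. -/
lemma eq_of_weighted_sum {w : ℂ} (hwn : ‖w‖ = 1) (n : ι → ℕ) (c : ι → ℂ)
    (hc : ∀ t, ‖c t‖ ≤ M.qdim t)
    (hs : ∑ t, (n t : ℂ) * c t = w * ((∑ t, (n t : ℝ) * M.qdim t : ℝ) : ℂ)) {r : ι}
    (hr : 0 < n r) : c r = w * M.qdim r := by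
  have hww : conj w * w = 1 := by
    rw [mul_comm, Complex.mul_conj, Complex.normSq_eq_norm_sq, hwn]; simp
  have hnorm : ∀ t, ‖conj w * c t‖ ≤ M.qdim t := fun t => by
    rw [norm_mul, Complex.norm_conj, hwn, one_mul]
    exact hc t
  have hbound : ∀ t, (conj w * c t).re ≤ M.qdim t := fun t =>
    (Complex.re_le_norm _).trans (hnorm t)
  have hsum : ∑ t, (n t : ℝ) * (M.qdim t - (conj w * c t).re) = 0 := by
    have h1 : ∑ t, (n t : ℂ) * (conj w * c t)
        = ((∑ t, (n t : ℝ) * M.qdim t : ℝ) : ℂ) := by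
      calc ∑ t, (n t : ℂ) * (conj w * c t)
          = conj w * ∑ t, (n t : ℂ) * c t := by
            rw [Finset.mul_sum]; exact Finset.sum_congr rfl fun t _ => by ring
        _ = _ := by rw [hs, ← mul_assoc, hww, one_mul]
    have h2 := congrArg Complex.re h1
    rw [Complex.ofReal_re, Complex.re_sum] at h2
    simp only [mul_sub, Finset.sum_sub_distrib]
    rw [sub_eq_zero, ← h2]
    refine Finset.sum_congr rfl fun t _ => ?_
    rw [← Complex.ofReal_natCast, Complex.re_ofReal_mul]
  have h0 := (Finset.sum_eq_zero_iff_of_nonneg (fun t _ =>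
    mul_nonneg (Nat.cast_nonneg (n t)) (sub_nonneg.2 (hbound t)))).1 hsum r
      (Finset.mem_univ r)
  have hre : (conj w * c r).re = M.qdim r := by
    rcases mul_eq_zero.1 h0 with h | h
    · exact absurd h (by exact_mod_cast hr.ne')
    · linarith
  have him : (conj w * c r).im = 0 := by
    have h3 := Complex.sq_norm (conj w * c r)
    rw [Complex.normSq_apply, hre] at h3
    have h4 := pow_le_pow_left₀ (norm_nonneg _) (hnorm r) 2
    nlinarith [mul_self_nonneg (conj w * c r).im]
  have heq : conj w * c r = M.qdim r := by
    apply Complex.ext <;> simp [hre, him]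
  calc c r = (conj w * w) * c r := by rw [hww, one_mul]
    _ = w * (conj w * c r) := by ring
    _ = _ := by rw [heq]

/-- If a representation attains the maximal modulus on `p` and `q`, then it is multiplicative with
respect to the constituents of the fusion product of `p` and `q`. -/
lemma irrep_scalar_fusion {s p q r : ι} {u v : ℂ} (hu : ‖u‖ = 1) (hv : ‖v‖ = 1)
    (hp : M.irrep s p = u * M.qdim p) (hq : M.irrep s q = v * M.qdim q) (hr : 0 < M.N p q r) :
    M.irrep s r = u * v * M.qdim r := by
  refine M.eq_of_weighted_sum (by rw [norm_mul, hu, hv, one_mul]) (M.N p q) (M.irrep s)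
    (M.norm_irrep_le s) ?_ hr
  rw [← M.irrep_mul, ← M.qdim_mul, hp, hq]
  push_cast
  ring

lemma exists_fusion (p q : ι) : ∃ r, 0 < M.N p q r := by
  by_contra! h
  have h1 := M.qdim_mul p q
  rw [Finset.sum_eq_zero fun r _ => by rw [Nat.le_zero.1 (h r)]; simp] at h1
  exact (mul_pos (M.qdim_pos p) (M.qdim_pos q)).ne' h1

lemma N_comm (p q r : ι) : M.N p q r = M.N q p r := by
  have : (M.N p q r : ℂ) = M.N q p r := by
    rw [M.verlinde, M.verlinde]
    exact Finset.sum_congr rfl fun s _ => by ring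
  exact_mod_cast this

lemma N_vac_left (r : ι) : M.N M.vac r r = 1 := by
  have : (M.N M.vac r r : ℂ) = 1 := by
    have h := M.row_orth r r
    rw [if_pos rfl] at h
    rw [M.verlinde, ← h]
    refine Finset.sum_congr rfl fun s _ => ?_
    have := M.S_vac_ne s
    field_simp
  exact_mod_cast this

lemma sum_N_vac (p t : ι) : ∑ q, (M.N p q M.vac : ℂ) * conj (M.S q t) = M.S p t := by
  calc ∑ q, (M.N p q M.vac : ℂ) * conj (M.S q t)
      = ∑ q, ∑ s, M.S p s * (conj (M.S q t) * M.S q s) := by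
        refine Finset.sum_congr rfl fun q _ => ?_
        rw [M.verlinde, Finset.sum_mul]
        refine Finset.sum_congr rfl fun s _ => ?_
        have := M.S_vac_ne s
        rw [M.conj_S_vac]
        field_simp
    _ = ∑ s, M.S p s * ∑ q, (conj (M.S q t) * M.S q s) := by
        rw [Finset.sum_comm]
        exact Finset.sum_congr rfl fun t _ => by rw [Finset.mul_sum]
    _ = _ := by simp [M.col_orth]

lemma sum_N_vac_irrep (p s : ι) :
    ∑ q, (M.N p q M.vac : ℂ) * conj (M.irrep s q) = M.irrep s p := by
  rw [irrep, ← M.sum_N_vac p s, Finset.sum_div]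
  refine Finset.sum_congr rfl fun q _ => ?_
  rw [irrep, map_div₀, M.conj_S_vac, mul_div_assoc]

/-- Every primary has a charge conjugate. -/
lemma exists_conj (p : ι) : ∃ q, 0 < M.N p q M.vac := by
  by_contra! h
  have h1 := M.sum_N_vac p M.vac
  rw [Finset.sum_eq_zero fun r _ => by rw [Nat.le_zero.1 (h r)]; simp] at h1
  exact M.S_vac_ne p (by rw [M.S_comm, ← h1])

lemma irrep_conj {p p' α : ι} {u : ℂ} (hu : ‖u‖ = 1) (hp : M.irrep p α = u * M.qdim α)
    (h : 0 < M.N p p' M.vac) : M.irrep p' α = u⁻¹ * M.qdim α := by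
  have h1 := M.eq_of_weighted_sum hu (fun q => M.N p q M.vac) (fun q => conj (M.irrep α q))
    (fun t => by rw [Complex.norm_conj]; exact M.norm_irrep_le α t) ?_ h
  · refine M.irrep_scalar_swap ?_
    have h2 := congrArg conj h1
    rw [Complex.conj_conj, map_mul, Complex.conj_ofReal] at h2
    rw [h2, Complex.inv_def, Complex.normSq_eq_norm_sq, hu]
    simp
  · rw [M.sum_N_vac_irrep, M.irrep_scalar_swap hp]
    congr 1
    have h3 := M.sum_N_vac_irrep p M.vac
    simp only [irrep_vac, Complex.conj_ofReal] at h3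
    rw [← h3]
    push_cast
    rfl

lemma exists_rotate {p p' : ι} (h : 0 < M.N p p' M.vac) (r : ι) :
    ∃ q, 0 < M.N p' r q ∧ 0 < M.N p q r := by
  have key : ∑ q, M.N p' r q * M.N p q r = ∑ t, M.N p p' t * M.N t r r := by
    have h1 : ∑ q, (M.N p' r q : ℂ) * (M.N p q r : ℂ)
        = ∑ s, M.S p s * M.S p' s * M.S r s * conj (M.S r s) / (M.S M.vac s) ^ 2 := by
      calc ∑ q, (M.N p' r q : ℂ) * (M.N p q r : ℂ)
          = ∑ q, ∑ s, (M.S p s * conj (M.S r s) / M.S M.vac s)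
              * ((M.N p' r q : ℂ) * M.S q s) := by
            refine Finset.sum_congr rfl fun q _ => ?_
            rw [M.verlinde p q r, Finset.mul_sum]
            exact Finset.sum_congr rfl fun s _ => by ring
        _ = _ := by
            rw [Finset.sum_comm]
            refine Finset.sum_congr rfl fun s _ => ?_
            rw [← Finset.mul_sum, M.fusion_S]
            ring
    have h2 : ∑ t, (M.N p p' t : ℂ) * (M.N t r r : ℂ)
        = ∑ s, M.S p s * M.S p' s * M.S r s * conj (M.S r s) / (M.S M.vac s) ^ 2 := by
      calc ∑ t, (M.N p p' t : ℂ) * (M.N t r r : ℂ)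
          = ∑ t, ∑ s, (M.S r s * conj (M.S r s) / M.S M.vac s)
              * ((M.N p p' t : ℂ) * M.S t s) := by
            refine Finset.sum_congr rfl fun t _ => ?_
            rw [M.verlinde t r r, Finset.mul_sum]
            exact Finset.sum_congr rfl fun s _ => by ring
        _ = _ := by
            rw [Finset.sum_comm]
            refine Finset.sum_congr rfl fun s _ => ?_
            rw [← Finset.mul_sum, M.fusion_S]
            ring
    have h3 := h1.trans h2.symm
    exact_mod_cast h3
  have hpos : 0 < ∑ t, M.N p p' t * M.N t r r :=
    Finset.sum_pos' (fun _ _ => Nat.zero_le _)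
      ⟨M.vac, Finset.mem_univ _, by rw [M.N_vac_left, mul_one]; exact h⟩
  rw [← key] at hpos
  obtain ⟨q, -, hq⟩ := Finset.exists_ne_zero_of_sum_ne_zero hpos.ne'
  exact ⟨q, Nat.pos_of_ne_zero (left_ne_zero_of_mul hq),
    Nat.pos_of_ne_zero (right_ne_zero_of_mul hq)⟩

/-! ### The deconstruction lattice and its classes -/

/-- The elements of the deconstruction lattice: sets of primaries that contain the vacuum and are
closed under the fusion product. -/
@[ext]
structure FCSet where
  carrier : Set ι
  vac_mem : M.vac ∈ carrier
  fusion_mem : ∀ p ∈ carrier, ∀ q ∈ carrier, ∀ r, 0 < M.N p q r → r ∈ carrier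

/-- The ordering of the deconstruction lattice is set inclusion. -/
instance : PartialOrder M.FCSet := PartialOrder.lift FCSet.carrier fun _ _ h => FCSet.ext h

variable {M}

namespace FCSet

/-- The `g`-class of `p`: the primaries whose irreducible representations coincide with that of `p`
when restricted to `g`. -/
def classOf (g : M.FCSet) (p : ι) : Set ι := {q | ∀ α ∈ g.carrier, M.irrep q α = M.irrep p α}

/-- `C` is one of the `g`-classes. -/
def IsClass (g : M.FCSet) (C : Set ι) : Prop := ∃ p, C = g.classOf p

/-- The trivial class `g^⊥`, that is the `g`-class of the vacuum. -/
def dual (g : M.FCSet) : Set ι := g.classOf M.vac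

end FCSet

variable (M) in
/-- The mass of a set of primaries: the sum of the squares of the quantum dimensions. -/
def mass (C : Set ι) : ℝ := ∑ p, C.indicator (fun p => M.qdim p ^ 2) p

namespace FCSet

/-- The central `g`-classes: those whose mass is minimal among all `g`-classes. -/
def IsCentralClass (g : M.FCSet) (z : Set ι) : Prop :=
  g.IsClass z ∧ ∀ C, g.IsClass C → M.mass z ≤ M.mass C

lemma mem_classOf_self (g : M.FCSet) (p : ι) : p ∈ g.classOf p := fun _ _ => rfl

lemma classOf_eq {g : M.FCSet} {p q : ι} (h : q ∈ g.classOf p) : g.classOf q = g.classOf p := by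
  ext r
  exact ⟨fun hr α hα => (hr α hα).trans (h α hα), fun hr α hα => (hr α hα).trans (h α hα).symm⟩

lemma IsClass.eq_classOf {g : M.FCSet} {C : Set ι} (hC : g.IsClass C) {p : ι} (hp : p ∈ C) :
    C = g.classOf p := by
  obtain ⟨q, rfl⟩ := hC
  exact (classOf_eq hp).symm

lemma isClass_dual (g : M.FCSet) : g.IsClass g.dual := ⟨M.vac, rfl⟩

lemma vac_mem_dual (g : M.FCSet) : M.vac ∈ g.dual := g.mem_classOf_self _

/-- The span of `g` in the fusion algebra, realized as functions on the set of primaries. -/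
def alg (g : M.FCSet) : Submodule ℂ (ι → ℂ) :=
  Submodule.span ℂ ((fun α p => M.irrep p α) '' g.carrier)

lemma one_mem_alg (g : M.FCSet) : (1 : ι → ℂ) ∈ g.alg :=
  Submodule.subset_span ⟨M.vac, g.vac_mem, funext fun p => M.irrep_vac_right p⟩

lemma mul_mem_alg (g : M.FCSet) (x y : ι → ℂ) (hx : x ∈ g.alg) (hy : y ∈ g.alg) :
    x * y ∈ g.alg := by
  have h := Submodule.mul_mem_mul hx hy
  rw [alg, Submodule.span_mul_span] at h
  refine (Submodule.span_le.2 ?_) h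
  rintro _ ⟨_, ⟨α, hα, rfl⟩, _, ⟨β, hβ, rfl⟩, rfl⟩
  have : ((fun p => M.irrep p α) * fun p => M.irrep p β)
      = ∑ r, (M.N α β r : ℂ) • (fun p => M.irrep p r) := by
    funext p
    simp [M.irrep_mul]
  change ((fun p => M.irrep p α) * fun p => M.irrep p β) ∈ g.alg
  rw [this]
  refine Submodule.sum_mem _ fun r _ => ?_
  rcases Nat.eq_zero_or_pos (M.N α β r) with h0 | h0
  · rw [h0]; simp
  · exact Submodule.smul_mem _ _
      (Submodule.subset_span ⟨r, g.fusion_mem α hα β hβ r h0, rfl⟩)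

open Classical in
lemma indicator_mem_alg (g : M.FCSet) (p : ι) :
    (fun q => if q ∈ g.classOf p then (1 : ℂ) else 0) ∈ g.alg := by
  let A : Subalgebra ℂ (ι → ℂ) := g.alg.toSubalgebra g.one_mem_alg g.mul_mem_alg
  have hsep : ∀ q, q ∉ g.classOf p → ∃ α ∈ g.carrier, M.irrep p α - M.irrep q α ≠ 0 := by
    intro q hq
    simp only [classOf, Set.mem_ofPred_eq, not_forall] at hq
    obtain ⟨α, hα, h⟩ := hq
    exact ⟨α, hα, fun h' => h (sub_eq_zero.1 h').symm⟩
  choose! a ha hne using hsep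
  have hf : (∏ q ∈ Finset.univ.filter (fun q => q ∉ g.classOf p),
      ((M.irrep p (a q) - M.irrep q (a q))⁻¹ •
        ((fun r => M.irrep r (a q)) - (M.irrep q (a q)) • (1 : ι → ℂ)))) ∈ A := by
    refine Subalgebra.prod_mem A fun q hq => ?_
    have hq' := (Finset.mem_filter.1 hq).2
    refine A.smul_mem (A.sub_mem ?_ (A.smul_mem A.one_mem _)) _
    exact Submodule.subset_span ⟨a q, ha q hq', rfl⟩
  convert (show _ ∈ g.alg from hf) using 1
  funext r
  rw [Finset.prod_apply]
  split_ifs with hr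
  · symm
    refine Finset.prod_eq_one fun q hq => ?_
    have hq' := (Finset.mem_filter.1 hq).2
    simp only [Pi.smul_apply, Pi.sub_apply, Pi.one_apply, smul_eq_mul, mul_one]
    rw [hr _ (ha q hq')]
    exact inv_mul_cancel₀ (hne q hq')
  · symm
    refine Finset.prod_eq_zero (Finset.mem_filter.2 ⟨Finset.mem_univ r, hr⟩) ?_
    simp

open Classical in
lemma alg_expand (g : M.FCSet) (f : ι → ℂ) (hf : f ∈ g.alg) (q : ι) :
    f q = ∑ β ∈ Finset.univ.filter (fun β => β ∈ g.carrier),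
      (∑ p, f p * (M.S M.vac p * conj (M.S β p))) * M.irrep q β := by
  induction hf using Submodule.span_induction with
  | mem x hx =>
    obtain ⟨α, hα, rfl⟩ := hx
    have h1 : ∀ β, ∑ p, M.irrep p α * (M.S M.vac p * conj (M.S β p))
        = if α = β then 1 else 0 := fun β => by
      rw [← M.row_orth α β]
      refine Finset.sum_congr rfl fun p _ => ?_
      have := M.S_vac_ne p
      simp only [irrep]
      field_simp
    simp [h1, hα]
  | zero => simp
  | add x y _ _ hx hy =>
    rw [Pi.add_apply, hx, hy, ← Finset.sum_add_distrib]
    refine Finset.sum_congr rfl fun β _ => ?_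
    simp only [Pi.add_apply, add_mul, Finset.sum_add_distrib]
  | smul c x _ hx =>
    rw [Pi.smul_apply, hx, smul_eq_mul, Finset.mul_sum]
    refine Finset.sum_congr rfl fun β _ => ?_
    simp only [Pi.smul_apply, smul_eq_mul, mul_assoc, ← Finset.mul_sum]

open Classical in
/-- The mass of a `g`-class in terms of the values of the corresponding representation. -/
lemma mass_classOf (g : M.FCSet) (p : ι) :
    M.mass (g.classOf p) * (M.S M.vac M.vac).re ^ 2 *
      ∑ β ∈ Finset.univ.filter (fun β => β ∈ g.carrier), ‖M.irrep p β‖ ^ 2 = 1 := by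
  have h := g.alg_expand _ (g.indicator_mem_alg p) p
  rw [if_pos (g.mem_classOf_self p)] at h
  have h2 : ∀ β ∈ Finset.univ.filter (fun β => β ∈ g.carrier),
      (∑ q, (if q ∈ g.classOf p then (1 : ℂ) else 0) * (M.S M.vac q * conj (M.S β q)))
        * M.irrep p β
      = ((M.mass (g.classOf p) * (M.S M.vac M.vac).re ^ 2 * ‖M.irrep p β‖ ^ 2 : ℝ) : ℂ) := by
    intro β hβ
    have hβ' := (Finset.mem_filter.1 hβ).2
    have h3 : ((‖M.irrep p β‖ ^ 2 : ℝ) : ℂ) = conj (M.irrep p β) * M.irrep p β := by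
      rw [mul_comm, Complex.mul_conj, Complex.normSq_eq_norm_sq]
    rw [Complex.ofReal_mul, h3, ← mul_assoc]
    congr 1
    rw [mass, Finset.sum_mul, Complex.ofReal_sum, Finset.sum_mul]
    refine Finset.sum_congr rfl fun q _ => ?_
    by_cases hq : q ∈ g.classOf p
    · rw [if_pos hq, Set.indicator_of_mem hq, ← hq β hβ']
      have h00 := M.S_vac_ne M.vac
      have h0q := M.S_vac_ne q
      simp only [irrep, qdim, map_div₀, M.conj_S_vac]
      push_cast
      simp only [M.S_vac_eq]
      field_simp
    · rw [if_neg hq, Set.indicator_of_notMem hq]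
      simp
  rw [Finset.sum_congr rfl h2, ← Complex.ofReal_sum, ← Finset.mul_sum] at h
  exact_mod_cast h.symm

lemma mass_dual_le (g : M.FCSet) (p : ι) : M.mass g.dual ≤ M.mass (g.classOf p) ∧
    (M.mass (g.classOf p) ≤ M.mass g.dual → ∀ α ∈ g.carrier, ‖M.irrep p α‖ = M.qdim α) ∧
    ((∀ α ∈ g.carrier, ‖M.irrep p α‖ = M.qdim α) → M.mass (g.classOf p) = M.mass g.dual) := by
  classical
  have h1 := g.mass_classOf p
  have h2 := g.mass_classOf M.vac
  change M.mass g.dual * _ * _ = 1 at h2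
  have hc : 0 < (M.S M.vac M.vac).re ^ 2 := pow_pos (M.S_vac_re _) 2
  have hnv : ∀ β, ‖M.irrep M.vac β‖ = M.qdim β := fun β => by
    rw [M.irrep_vac, Complex.norm_real, Real.norm_of_nonneg (M.qdim_pos β).le]
  simp only [hnv] at h2
  set F := Finset.univ.filter (fun β => β ∈ g.carrier) with hF
  set c := (M.S M.vac M.vac).re ^ 2
  have hterm : ∀ β ∈ F, ‖M.irrep p β‖ ^ 2 ≤ M.qdim β ^ 2 := fun β _ =>
    pow_le_pow_left₀ (norm_nonneg _) (M.norm_irrep_le p β) 2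
  have hle := Finset.sum_le_sum hterm
  have hn1 : 0 ≤ ∑ β ∈ F, ‖M.irrep p β‖ ^ 2 := Finset.sum_nonneg fun _ _ => sq_nonneg _
  have hn2 : 0 ≤ ∑ β ∈ F, M.qdim β ^ 2 := Finset.sum_nonneg fun _ _ => sq_nonneg _
  set a := ∑ β ∈ F, ‖M.irrep p β‖ ^ 2 with ha
  set b := ∑ β ∈ F, M.qdim β ^ 2 with hb
  have hmp : ∀ C : Set ι, 0 ≤ M.mass C := fun C =>
    Finset.sum_nonneg fun q _ => Set.indicator_nonneg (fun _ _ => sq_nonneg _) q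
  have hap : 0 < a := lt_of_le_of_ne hn1 fun h => by rw [← h] at h1; simp at h1
  have hbp : 0 < b := lt_of_le_of_ne hn2 fun h => by rw [← h] at h2; simp at h2
  have e1 : M.mass (g.classOf p) = 1 / (c * a) := by
    rw [eq_div_iff (mul_pos hc hap).ne', ← mul_assoc]; exact h1
  have e2 : M.mass g.dual = 1 / (c * b) := by
    rw [eq_div_iff (mul_pos hc hbp).ne', ← mul_assoc]; exact h2
  refine ⟨?_, ?_, ?_⟩
  · rw [e1, e2]
    exact one_div_le_one_div_of_le (mul_pos hc hap) (mul_le_mul_of_nonneg_left hle hc.le)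
  · intro h α hα
    rw [e1, e2, one_div_le_one_div (mul_pos hc hap) (mul_pos hc hbp)] at h
    have hba : b ≤ a := le_of_mul_le_mul_left h hc
    have h3 := (Finset.sum_eq_sum_iff_of_le hterm).1 (le_antisymm hle hba) α
      (by simp [hF, hα])
    exact (pow_left_inj₀ (norm_nonneg _) (M.qdim_pos α).le two_ne_zero).1 h3
  · intro h
    rw [e1, e2]
    have : a = b := Finset.sum_congr rfl fun β hβ => by
      rw [h β (Finset.mem_filter.1 hβ).2]
    rw [this]

/-- A `g`-class is central iff its mass is that of the trivial class. -/
lemma isCentralClass_iff_mass (g : M.FCSet) {C : Set ι} (hC : g.IsClass C) :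
    g.IsCentralClass C ↔ M.mass C = M.mass g.dual := by
  constructor
  · intro h
    refine le_antisymm (h.2 _ g.isClass_dual) ?_
    obtain ⟨p, rfl⟩ := hC
    exact (g.mass_dual_le p).1
  · intro h
    refine ⟨hC, ?_⟩
    rintro _ ⟨q, rfl⟩
    rw [h]
    exact (g.mass_dual_le q).1

lemma isCentralClass_classOf (g : M.FCSet) (p : ι) :
    g.IsCentralClass (g.classOf p) ↔ ∀ α ∈ g.carrier, ‖M.irrep p α‖ = M.qdim α := by
  rw [g.isCentralClass_iff_mass ⟨p, rfl⟩]
  exact ⟨fun h => (g.mass_dual_le p).2.1 h.le, (g.mass_dual_le p).2.2⟩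

/-! ### The center -/

/-- The center of `g`: the set of central `g`-classes. -/
def Center (g : M.FCSet) : Type _ := {z : Set ι // g.IsCentralClass z}

namespace Center

variable {g : M.FCSet}

/-- A central class, viewed as a collection of primaries. -/
def carrier (z : g.Center) : Set ι := z.1

@[ext]
lemma ext {z w : g.Center} (h : z.carrier = w.carrier) : z = w := Subtype.ext h

lemma nonempty (z : g.Center) : z.carrier.Nonempty := by
  obtain ⟨p, hp⟩ := z.2.1
  exact ⟨p, by rw [carrier, hp]; exact g.mem_classOf_self p⟩

lemma eq_classOf (z : g.Center) {p : ι} (hp : p ∈ z.carrier) : z.carrier = g.classOf p :=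
  z.2.1.eq_classOf hp

lemma eq_of_mem {z w : g.Center} {p : ι} (hz : p ∈ z.carrier) (hw : p ∈ w.carrier) : z = w :=
  ext ((z.eq_classOf hz).trans (w.eq_classOf hw).symm)

/-- The central character of a central class: the quotient of the value of the corresponding
representation of the fusion algebra by the quantum dimension (evaluated at any primary of the
class, see `char_eq`). -/
def char (z : g.Center) (α : ι) : ℂ := M.irrep z.nonempty.some α / M.qdim α

lemma char_eq (z : g.Center) {p α : ι} (hp : p ∈ z.carrier) (hα : α ∈ g.carrier) :
    z.char α = M.irrep p α / M.qdim α := by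
  have h : z.nonempty.some ∈ g.classOf p := by
    rw [← z.eq_classOf hp]
    exact z.nonempty.some_mem
  rw [char, h α hα]

lemma irrep_eq (z : g.Center) {p α : ι} (hp : p ∈ z.carrier) (hα : α ∈ g.carrier) :
    M.irrep p α = z.char α * M.qdim α := by
  rw [z.char_eq hp hα, div_mul_cancel₀ _ (M.qdim_ne α)]

lemma norm_char (z : g.Center) {α : ι} (hα : α ∈ g.carrier) : ‖z.char α‖ = 1 := by
  obtain ⟨p, hp⟩ := z.nonempty
  have h := z.2
  change g.IsCentralClass z.carrier at h
  rw [z.eq_classOf hp, g.isCentralClass_classOf] at h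
  rw [z.char_eq hp hα, norm_div, h α hα, Complex.norm_real,
    Real.norm_of_nonneg (M.qdim_pos α).le, div_self (M.qdim_pos α).ne']

/-- The multiplicativity of the central characters. -/
lemma char_fusion (z : g.Center) {α β γ : ι} (hα : α ∈ g.carrier) (hβ : β ∈ g.carrier)
    (h : 0 < M.N α β γ) : z.char γ = z.char α * z.char β := by
  obtain ⟨p, hp⟩ := z.nonempty
  have hγ := g.fusion_mem α hα β hβ γ h
  rw [z.char_eq hp hγ, M.irrep_scalar_fusion (z.norm_char hα) (z.norm_char hβ)
    (z.irrep_eq hp hα) (z.irrep_eq hp hβ) h, mul_div_cancel_right₀ _ (M.qdim_ne γ)]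

lemma irrep_fusion (z w : g.Center) {p q r α : ι} (hp : p ∈ z.carrier) (hq : q ∈ w.carrier)
    (h : 0 < M.N p q r) (hα : α ∈ g.carrier) :
    M.irrep r α = z.char α * w.char α * M.qdim α :=
  M.irrep_scalar_swap (M.irrep_scalar_fusion (z.norm_char hα) (w.norm_char hα)
    (M.irrep_scalar_swap (z.irrep_eq hp hα)) (M.irrep_scalar_swap (w.irrep_eq hq hα)) h)

/-- The `g`-class of `p` as an element of the center, when it is central. -/
def ofMem (g : M.FCSet) (p : ι) (h : ∀ α ∈ g.carrier, ‖M.irrep p α‖ = M.qdim α) : g.Center :=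
  ⟨g.classOf p, (g.isCentralClass_classOf p).2 h⟩

lemma mem_ofMem (g : M.FCSet) (p : ι) (h : ∀ α ∈ g.carrier, ‖M.irrep p α‖ = M.qdim α) :
    p ∈ (ofMem g p h).carrier := g.mem_classOf_self p

lemma norm_irrep (z : g.Center) {p : ι} (hp : p ∈ z.carrier) :
    ∀ α ∈ g.carrier, ‖M.irrep p α‖ = M.qdim α := by
  intro α hα
  rw [z.irrep_eq hp hα, norm_mul, z.norm_char hα, one_mul, Complex.norm_real,
    Real.norm_of_nonneg (M.qdim_pos α).le]

lemma norm_irrep_fusion (z w : g.Center) {p q r : ι} (hp : p ∈ z.carrier) (hq : q ∈ w.carrier)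
    (h : 0 < M.N p q r) : ∀ α ∈ g.carrier, ‖M.irrep r α‖ = M.qdim α := by
  intro α hα
  rw [z.irrep_fusion w hp hq h hα, norm_mul, norm_mul, z.norm_char hα, w.norm_char hα, one_mul,
    one_mul, Complex.norm_real, Real.norm_of_nonneg (M.qdim_pos α).le]

lemma char_ne_zero (z : g.Center) {α : ι} (hα : α ∈ g.carrier) : z.char α ≠ 0 := by
  have h := z.norm_char hα
  intro h0
  rw [h0] at h
  simp at h

lemma mem_of_irrep_eq (z : g.Center) {p : ι}
    (h : ∀ α ∈ g.carrier, M.irrep p α = z.char α * M.qdim α) : p ∈ z.carrier := by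
  obtain ⟨q, hq⟩ := z.nonempty
  rw [z.eq_classOf hq]
  intro α hα
  rw [h α hα, z.irrep_eq hq hα]

/-- A central class is determined by its central character. -/
lemma ext_char {z w : g.Center} (h : ∀ α ∈ g.carrier, z.char α = w.char α) : z = w := by
  obtain ⟨p, hp⟩ := z.nonempty
  exact eq_of_mem hp (w.mem_of_irrep_eq fun α hα => by rw [← h α hα, z.irrep_eq hp hα])

/-- The fusion product of two central classes is a central class. -/
lemma isCentralClass_fusion (z w : g.Center) :
    g.IsCentralClass {r | ∃ p ∈ z.carrier, ∃ q ∈ w.carrier, 0 < M.N p q r} := by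
  obtain ⟨p, hp⟩ := z.nonempty
  obtain ⟨q, hq⟩ := w.nonempty
  obtain ⟨r, hr⟩ := M.exists_fusion p q
  have hset : {r | ∃ p ∈ z.carrier, ∃ q ∈ w.carrier, 0 < M.N p q r} = g.classOf r := by
    ext t
    constructor
    · rintro ⟨p₁, hp₁, q₁, hq₁, ht⟩ α hα
      rw [z.irrep_fusion w hp₁ hq₁ ht hα, z.irrep_fusion w hp hq hr hα]
    · intro ht
      obtain ⟨p', hp'⟩ := M.exists_conj p
      obtain ⟨q₁, h1, h2⟩ := M.exists_rotate hp' t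
      refine ⟨p, hp, q₁, w.mem_of_irrep_eq fun α hα => ?_, h2⟩
      have hz := z.norm_char hα
      have hw := w.norm_char hα
      have hz0 := z.char_ne_zero hα
      have hp'val : M.irrep p' α = (z.char α)⁻¹ * M.qdim α :=
        M.irrep_conj hz (z.irrep_eq hp hα) hp'
      have htval : M.irrep t α = z.char α * w.char α * M.qdim α := by
        rw [ht α hα, z.irrep_fusion w hp hq hr hα]
      have h5 := M.irrep_scalar_swap (M.irrep_scalar_fusion (s := α)
        (by rw [norm_inv, hz, inv_one]) (by rw [norm_mul, hz, hw, one_mul])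
        (M.irrep_scalar_swap hp'val) (M.irrep_scalar_swap htval) h1)
      rw [h5]
      field_simp
  rw [hset, g.isCentralClass_classOf]
  exact z.norm_irrep_fusion w hp hq hr

/-- The product in the center is induced by the fusion product. -/
instance : Mul g.Center :=
  ⟨fun z w => ⟨{r | ∃ p ∈ z.carrier, ∃ q ∈ w.carrier, 0 < M.N p q r}, isCentralClass_fusion z w⟩⟩

/-- The identity element of the center is the trivial class. -/
instance : One g.Center :=
  ⟨⟨g.dual, (g.isCentralClass_iff_mass g.isClass_dual).2 rfl⟩⟩

/-- The inverse of a central class is the central class of the charge conjugate primaries. -/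
instance : Inv g.Center :=
  ⟨fun z => ofMem g (M.exists_conj z.nonempty.some).choose fun α hα => by
    rw [M.irrep_conj (z.norm_char hα) (z.irrep_eq z.nonempty.some_mem hα)
      (M.exists_conj z.nonempty.some).choose_spec, norm_mul, norm_inv, z.norm_char hα, inv_one,
      one_mul, Complex.norm_real, Real.norm_of_nonneg (M.qdim_pos α).le]⟩

lemma mem_mul {z w : g.Center} {r : ι} :
    r ∈ (z * w).carrier ↔ ∃ p ∈ z.carrier, ∃ q ∈ w.carrier, 0 < M.N p q r := Iff.rfl

lemma carrier_one : (1 : g.Center).carrier = g.dual := rfl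

lemma char_one {α : ι} (hα : α ∈ g.carrier) : (1 : g.Center).char α = 1 := by
  rw [char_eq 1 (p := M.vac) g.vac_mem_dual hα, M.irrep_vac, div_self (M.qdim_ne α)]

lemma char_mul (z w : g.Center) {α : ι} (hα : α ∈ g.carrier) :
    (z * w).char α = z.char α * w.char α := by
  obtain ⟨r, hr⟩ := (z * w).nonempty
  obtain ⟨p, hp, q, hq, h⟩ := mem_mul.1 hr
  rw [(z * w).char_eq hr hα, z.irrep_fusion w hp hq h hα, mul_div_cancel_right₀ _ (M.qdim_ne α)]

lemma char_inv (z : g.Center) {α : ι} (hα : α ∈ g.carrier) : (z⁻¹).char α = (z.char α)⁻¹ := by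
  rw [char_eq z⁻¹ (mem_ofMem g _ _) hα, M.irrep_conj (z.norm_char hα)
    (z.irrep_eq z.nonempty.some_mem hα) (M.exists_conj z.nonempty.some).choose_spec,
    mul_div_cancel_right₀ _ (M.qdim_ne α)]

/-- The center is an abelian group. -/
instance : CommGroup g.Center where
  mul_assoc x y z := ext_char fun α hα => by simp only [char_mul _ _ hα, mul_assoc]
  one_mul x := ext_char fun α hα => by rw [char_mul _ _ hα, char_one hα, one_mul]
  mul_one x := ext_char fun α hα => by rw [char_mul _ _ hα, char_one hα, mul_one]
  mul_comm x y := ext_char fun α hα => by rw [char_mul _ _ hα, char_mul _ _ hα, mul_comm]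
  inv_mul_cancel x := ext_char fun α hα => by
    rw [char_mul _ _ hα, char_inv _ hα, char_one hα, inv_mul_cancel₀ (x.char_ne_zero hα)]

end Center

/-- The union of a set of central classes, viewed as collections of primaries. -/
def union {g : M.FCSet} (H : Set g.Center) : Set ι := ⋃ z ∈ H, z.carrier

/-! ### Central quotients -/

/-- The central quotient `g/H`: the elements of `g` on which the central characters of all elements
of the subgroup `H` of the center are trivial. -/
def centralQuotient (g : M.FCSet) (H : Subgroup g.Center) : M.FCSet where
  carrier := {α | α ∈ g.carrier ∧ ∀ z ∈ H, z.char α = 1}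
  vac_mem := ⟨g.vac_mem, fun z _ => by
    obtain ⟨p, hp⟩ := z.nonempty
    rw [z.char_eq hp g.vac_mem, M.irrep_vac_right, ← M.irrep_vac, M.irrep_vac_right, div_one]⟩
  fusion_mem := fun p hp q hq r hr => ⟨g.fusion_mem p hp.1 q hq.1 r hr, fun z hz => by
    rw [z.char_fusion hp.1 hq.1 hr, hp.2 z hz, hq.2 z hz, mul_one]⟩

/-- The maximal central quotient `∂g`. -/
def maxCentralQuotient (g : M.FCSet) : M.FCSet := g.centralQuotient ⊤

/-- `h` is a central quotient of `g`. -/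
def IsCentralQuotient (h g : M.FCSet) : Prop := ∃ H : Subgroup g.Center, h = g.centralQuotient H

lemma le_def {h g : M.FCSet} : h ≤ g ↔ h.carrier ⊆ g.carrier := Iff.rfl

lemma IsCentralQuotient.le {h g : M.FCSet} (hg : h.IsCentralQuotient g) : h ≤ g := by
  obtain ⟨H, rfl⟩ := hg
  exact fun _ hα => hα.1

lemma IsCentralQuotient.maxCentralQuotient_le {h g : M.FCSet} (hg : h.IsCentralQuotient g) :
    g.maxCentralQuotient ≤ h := by
  obtain ⟨H, rfl⟩ := hg
  exact fun _ hα => ⟨hα.1, fun z _ => hα.2 z trivial⟩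

/-! ### The restriction homomorphism -/

/-- For `h ⊆ g`, any `h`-class that contains a central `g`-class is itself central. -/
lemma isCentralClass_of_subset {h g : M.FCSet} (hg : h ≤ g) (z : g.Center) {C : Set ι}
    (hC : h.IsClass C) (hz : z.carrier ⊆ C) : h.IsCentralClass C := by
  obtain ⟨p, hp⟩ := z.nonempty
  rw [hC.eq_classOf (hz hp), isCentralClass_classOf]
  exact fun α hα => z.norm_irrep hp α (hg hα)

lemma existsUnique_class {h g : M.FCSet} (hg : h ≤ g) (z : g.Center) :
    ∃! w : h.Center, z.carrier ⊆ w.carrier := by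
  obtain ⟨p, hp⟩ := z.nonempty
  have hsub : z.carrier ⊆ h.classOf p := by
    rw [z.eq_classOf hp]
    exact fun q hq α hα => hq α (hg hα)
  exact ⟨⟨h.classOf p, isCentralClass_of_subset hg z ⟨p, rfl⟩ hsub⟩, hsub,
    fun w hw => Center.eq_of_mem (hw hp) (h.mem_classOf_self p)⟩

/-- The restriction homomorphism, assigning to a central `g`-class the unique `h`-class that
contains it, for `h ⊆ g`. -/
def restriction {h g : M.FCSet} (hg : h ≤ g) : g.Center →* h.Center :=
  MonoidHom.mk' (fun z => (existsUnique_class hg z).choose) fun z w => by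
    obtain ⟨r, hr⟩ := (z * w).nonempty
    obtain ⟨p, hp, q, hq, hN⟩ := Center.mem_mul.1 hr
    exact Center.eq_of_mem ((existsUnique_class hg (z * w)).choose_spec.1 hr)
      (Center.mem_mul.2 ⟨p, (existsUnique_class hg z).choose_spec.1 hp, q,
        (existsUnique_class hg w).choose_spec.1 hq, hN⟩)

lemma subset_restriction {h g : M.FCSet} (hg : h ≤ g) (z : g.Center) :
    z.carrier ⊆ (restriction hg z).carrier := (existsUnique_class hg z).choose_spec.1

/-- `Z(g|h)`, the kernel of the restriction homomorphism. -/
def restrictionKer {h g : M.FCSet} (hg : h ≤ g) : Subgroup g.Center := (restriction hg).ker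

/-- `I(g|h)`, the image of the restriction homomorphism. -/
def restrictionImage {h g : M.FCSet} (hg : h ≤ g) : Subgroup h.Center := (restriction hg).range

/-- `Z(g|h)` consists of the central `g`-classes contained in the trivial `h`-class. -/
lemma mem_restrictionKer {h g : M.FCSet} (hg : h ≤ g) {z : g.Center} :
    z ∈ restrictionKer hg ↔ z.carrier ⊆ h.dual := by
  constructor
  · intro hz
    have h1 := subset_restriction hg z
    rwa [show restriction hg z = 1 from hz] at h1
  · intro hz
    obtain ⟨p, hp⟩ := z.nonempty
    exact Center.eq_of_mem (subset_restriction hg z hp) (hz hp)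

end FCSet
end ConformalModel
end

namespace ConformalModel

variable {ι : Type*} [Fintype ι] [DecidableEq ι] {M : ConformalModel ι}

/-! Write p ⊥ α when ρ_p(α) = d_α. As S is symmetric this relation is symmetric in p and α
(`irrep_eq_qdim_swap`), and g^⊥ consists of the primaries orthogonal to all of g. Everything rests
on the duality g^⊥⊥ = g, of which `mem_of_forall_mem_dual` is the hard half. It is a Fourier
argument: the indicator function of g^⊥ lies in the span of g, hence pairs to zero with every
primary outside g, whereas a primary orthogonal to g^⊥ would pair with it to a positive number.

The central step is `union_eq_dual_centralQuotient`: for any subgroup H of the center of g, ∪H =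
(g/H)^⊥. The set K = ∪H is closed under fusion because H is closed under products, so duality
applies to K as well as to g. For α in g and z in H, triviality of the central character of z at α
means that α is orthogonal to z. So K ⊆ (g/H)^⊥ by definition, while K^⊥ ⊆ g/H by duality for g;
then (g/H)^⊥ ⊆ K^⊥⊥ = K.

What remains is to see that h = g/Z(g|h) and that h/I(g|h) = ∂g. Applying the union formula to these
two quotients gives both displayed identities. Distinct central classes are disjoint, so a set of
them is determined by its union, and I(g|h) = Z(h|∂g) follows from ∪I(g|h) = (∂g)^⊥. -/

lemma irrep_eq_qdim_swap {p α : ι} (h : M.irrep p α = M.qdim α) : M.irrep α p = M.qdim p := by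
  simpa using M.irrep_scalar_swap (u := 1) (by rw [h, one_mul])

namespace FCSet

/-! ### Duality in the deconstruction lattice -/

lemma mem_dual {g : M.FCSet} {p : ι} : p ∈ g.dual ↔ ∀ α ∈ g.carrier, M.irrep p α = M.qdim α := by
  simp only [dual, classOf, irrep_vac]
  rfl

/-- The functions given by primaries outside `g` are orthogonal to the span of `g`. -/
lemma sum_mul_conj_S_eq_zero (g : M.FCSet) {f : ι → ℂ} (hf : f ∈ g.alg) {β : ι}
    (hβ : β ∉ g.carrier) : ∑ p, f p * (M.S M.vac p * conj (M.S β p)) = 0 := by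
  induction hf using Submodule.span_induction with
  | mem x hx =>
    obtain ⟨α, hα, rfl⟩ := hx
    have hne : α ≠ β := fun h => hβ (h ▸ hα)
    -- The weight S_0p cancels the denominator of ρ_p(α), so the pairing of α with β is an entry of
    -- S S*, which is zero off the diagonal.
    have h := M.row_orth α β
    rw [if_neg hne] at h
    rw [← h]
    refine Finset.sum_congr rfl fun p _ => ?_
    have := M.S_vac_ne p
    simp only [irrep]
    field_simp
  | zero => simp
  | add x y _ _ hx hy => simp only [Pi.add_apply, add_mul, Finset.sum_add_distrib, hx, hy, add_zero]
  | smul c x _ hx =>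
    simp only [Pi.smul_apply, smul_eq_mul, mul_assoc, ← Finset.mul_sum, hx, mul_zero]

/-- The nontrivial inclusion in the duality `g^⊥⊥ = g`. -/
lemma mem_of_forall_mem_dual (g : M.FCSet) {β : ι}
    (h : ∀ p ∈ g.dual, M.irrep p β = M.qdim β) : β ∈ g.carrier := by
  classical
  by_contra hβ
  have h1 := g.sum_mul_conj_S_eq_zero (g.indicator_mem_alg M.vac) hβ
  -- On g^⊥ the assumption gives S_βp = d_β S_0p with S_0p real, so the vanishing pairing equals d_β
  -- times the sum of S_0p² over g^⊥.
  have h2 : ∀ p, (if p ∈ g.classOf M.vac then (1 : ℂ) else 0) * (M.S M.vac p * conj (M.S β p))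
      = M.qdim β *
        ((if p ∈ g.classOf M.vac then (M.S M.vac p).re ^ 2 else 0 : ℝ) : ℂ) := by
    intro p
    split_ifs with hp
    · have h3 : M.S β p = M.qdim β * M.S M.vac p := by
        rw [← h p hp, irrep, div_mul_cancel₀ _ (M.S_vac_ne p)]
      rw [h3, map_mul, Complex.conj_ofReal, M.conj_S_vac]
      push_cast
      rw [M.S_vac_eq]
      ring
    · simp
  rw [Finset.sum_congr rfl fun p _ => h2 p, ← Finset.mul_sum, ← Complex.ofReal_sum] at h1
  have h4 := (mul_eq_zero.1 h1).resolve_left (M.qdim_ne β)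
  -- The vacuum lies in g^⊥, so this sum has at least one positive term.
  have h5 : 0 < ∑ p, if p ∈ g.classOf M.vac then (M.S M.vac p).re ^ 2 else 0 := by
    refine Finset.sum_pos' (fun p _ => ?_) ⟨M.vac, Finset.mem_univ _, ?_⟩
    · split_ifs <;> positivity
    · rw [if_pos (g.mem_classOf_self _)]
      exact pow_pos (M.S_vac_re _) 2
  exact h5.ne' (by exact_mod_cast h4)

/-! ### Unions of central classes and duals of central quotients -/

lemma mem_union {g : M.FCSet} {H : Set g.Center} {p : ι} :
    p ∈ union H ↔ ∃ z ∈ H, p ∈ z.carrier := by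
  simp [union]

/-- Central classes are nonempty and two that share a primary coincide, so no information is lost in
passing from a set of classes to its union. This turns equalities of unions into equalities of
subgroups. -/
lemma mem_iff_carrier_subset_union {g : M.FCSet} {H : Set g.Center} {z : g.Center} :
    z ∈ H ↔ z.carrier ⊆ union H := by
  refine ⟨fun hz p hp => mem_union.2 ⟨z, hz, hp⟩, fun hz => ?_⟩
  obtain ⟨p, hp⟩ := z.nonempty
  obtain ⟨w, hw, hpw⟩ := mem_union.1 (hz hp)
  rwa [Center.eq_of_mem hp hpw]

/-- The union of a subgroup of the center, as an element of the deconstruction lattice. -/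
def unionSubgroup {g : M.FCSet} (H : Subgroup g.Center) : M.FCSet where
  carrier := union (H : Set g.Center)
  vac_mem := mem_union.2 ⟨1, H.one_mem, g.vac_mem_dual⟩
  fusion_mem := by
    intro p hp q hq r hr
    obtain ⟨z, hz, hpz⟩ := mem_union.1 hp
    obtain ⟨w, hw, hqw⟩ := mem_union.1 hq
    exact mem_union.2 ⟨z * w, H.mul_mem hz hw, Center.mem_mul.2 ⟨p, hpz, q, hqw, hr⟩⟩

lemma Center.char_eq_one_iff {g : M.FCSet} (z : g.Center) {p α : ι} (hp : p ∈ z.carrier)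
    (hα : α ∈ g.carrier) : z.char α = 1 ↔ M.irrep p α = M.qdim α := by
  rw [z.char_eq hp hα, div_eq_one_iff_eq (M.qdim_ne α)]

lemma dual_unionSubgroup_subset {g : M.FCSet} (H : Subgroup g.Center) :
    (unionSubgroup H).dual ⊆ (g.centralQuotient H).carrier := by
  intro α hα
  rw [mem_dual] at hα
  -- The identity of H is the class g^⊥, so α is orthogonal to g^⊥ and duality places it in g. Only
  -- then do central characters at α have a meaning.
  have hαg : α ∈ g.carrier := g.mem_of_forall_mem_dual fun p hp =>
    irrep_eq_qdim_swap (hα p (mem_union.2 ⟨1, H.one_mem, hp⟩))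
  refine ⟨hαg, fun z hz => ?_⟩
  obtain ⟨p, hp⟩ := z.nonempty
  exact (z.char_eq_one_iff hp hαg).2 (irrep_eq_qdim_swap (hα p (mem_union.2 ⟨z, hz, hp⟩)))

/-- One inclusion unfolds the definition of g/H. The other dualizes `dual_unionSubgroup_subset` and
uses duality for the union itself. -/
lemma union_eq_dual_centralQuotient {g : M.FCSet} (H : Subgroup g.Center) :
    union (H : Set g.Center) = (g.centralQuotient H).dual := by
  ext q
  refine ⟨fun hq => mem_dual.2 fun α hα => ?_, fun hq => ?_⟩
  · obtain ⟨z, hz, hqz⟩ := mem_union.1 hq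
    exact (z.char_eq_one_iff hqz hα.1).1 (hα.2 z hz)
  · exact (unionSubgroup H).mem_of_forall_mem_dual fun p hp =>
      irrep_eq_qdim_swap (mem_dual.1 hq p (dual_unionSubgroup_subset H hp))

/-! ### Kernel and image of the restriction homomorphism -/

lemma char_restriction {h g : M.FCSet} (hg : h ≤ g) (z : g.Center) {α : ι}
    (hα : α ∈ h.carrier) : (restriction hg z).char α = z.char α := by
  obtain ⟨p, hp⟩ := z.nonempty
  rw [Center.char_eq _ (subset_restriction hg z hp) hα, z.char_eq hp (hg hα)]

/-- If h = g/H, then every class in H lies in h^⊥, so H is contained in Z(g|h) and g/Z(g|h) ⊆ h.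
Conversely, the classes in Z(g|h) have trivial characters on h, because they lie in h^⊥. -/
lemma IsCentralQuotient.eq_centralQuotient_restrictionKer {h g : M.FCSet}
    (hg : h.IsCentralQuotient g) : h = g.centralQuotient (restrictionKer hg.le) := by
  ext α
  constructor
  · refine fun hα => ⟨hg.le hα, fun z hz => ?_⟩
    obtain ⟨p, hp⟩ := z.nonempty
    exact (z.char_eq_one_iff hp (hg.le hα)).2
      (mem_dual.1 ((mem_restrictionKer hg.le).1 hz hp) α hα)
  · obtain ⟨H, rfl⟩ := hg
    refine fun hα => ⟨hα.1, fun z hz => hα.2 z ((mem_restrictionKer _).2 ?_)⟩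
    rw [← union_eq_dual_centralQuotient]
    exact mem_iff_carrier_subset_union.1 hz

/-- Restricting a central class restricts its central character, so on h the conditions imposed by
I(g|h) are exactly those imposed by the whole center of g. -/
lemma IsCentralQuotient.centralQuotient_restrictionImage {h g : M.FCSet}
    (hg : h.IsCentralQuotient g) :
    h.centralQuotient (restrictionImage hg.le) = g.maxCentralQuotient := by
  ext α
  constructor
  · refine fun hα => ⟨hg.le hα.1, fun z _ => ?_⟩
    rw [← char_restriction hg.le z hα.1]
    exact hα.2 _ ⟨z, rfl⟩
  · intro hα
    -- Membership in h is needed first, since the characters of a class and of its restriction are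
    -- compared only on h.
    have hαh := hg.maxCentralQuotient_le hα
    refine ⟨hαh, ?_⟩
    rintro _ ⟨z, rfl⟩
    rw [char_restriction hg.le z hαh]
    exact hα.2 z trivial

end FCSet
end ConformalModel

theorem mainTheorem2 {ι : Type*} [Fintype ι] [DecidableEq ι] (M : ConformalModel ι)
    (g h : M.FCSet) (hgh : h.IsCentralQuotient g) :
    ConformalModel.FCSet.union
        (ConformalModel.FCSet.restrictionKer hgh.le : Set g.Center) = h.dual ∧
      ConformalModel.FCSet.union
        (ConformalModel.FCSet.restrictionImage hgh.le : Set h.Center) =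
          g.maxCentralQuotient.dual ∧
      h = g.centralQuotient (ConformalModel.FCSet.restrictionKer hgh.le) ∧
      h.centralQuotient (ConformalModel.FCSet.restrictionImage hgh.le) = g.maxCentralQuotient ∧
      ConformalModel.FCSet.restrictionImage hgh.le =
        ConformalModel.FCSet.restrictionKer hgh.maxCentralQuotient_le := by
  have h3 := hgh.eq_centralQuotient_restrictionKer
  have h4 := hgh.centralQuotient_restrictionImage
  have h2 := ConformalModel.FCSet.union_eq_dual_centralQuotient
    (ConformalModel.FCSet.restrictionImage hgh.le)
  -- The union formula for I(g|h) concerns h/I(g|h), which has just been identified with ∂g.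
  rw [h4] at h2
  refine ⟨?_, h2, h3, h4, ?_⟩
  · rw [ConformalModel.FCSet.union_eq_dual_centralQuotient, ← h3]
  · ext z
    -- A central h-class lies in Z(h|∂g) when it is contained in (∂g)^⊥ = ∪I(g|h), and by
    -- disjointness of classes this means that it belongs to I(g|h).
    rw [ConformalModel.FCSet.mem_restrictionKer, ← h2,
      ← ConformalModel.FCSet.mem_iff_carrier_subset_union, SetLike.mem_coe]
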